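/- **Model.** A line network is a path with at least one edge, with positive real edge lengths, whose nodes carry port numbers $1,\dots,d$ ($d$ the degree of the node). A configuration places $n$ agents at distinct nodes $Pos[1]<\dots<Pos[n]$ of a line network, with an agent at each end of the line. All agents start simultaneously; at any time each of them waits or moves at speed one along the line, and agents that are at the same point (a node or a point inside an edge) exchange all the information they hold. Initially each agent holds its own piece of information. Convergecast is achieved when some agent holds the initial information of all agents, and broadcast from a source agent is achieved when all agents hold the initial information of the source agent. A task is solved with power $P$ if it is achieved while every agent travels a distance of at most $P$. A centralized strategy prescribes a finite sequence of movements for every agent, with full knowledge of the configuration. In a deterministic distributed algorithm the agents are anonymous, do not know the network and the configuration, and all execute the same deterministic algorithm. Initially an agent knows only its power, the degree of its starting node and whether it is the source agent. Later, its decisions depend only on the time, on the degrees of the nodes that it visits and the ports through which it enters them, and on its meetings: it notices the agents at its current location, learns the direction from which each of them has come, and they exchange all their information. **Theorem.** For every real $\delta>0$ and every real $P>0$ there exist an integer $n$ and a configuration $Pos[1:n]$ of $n$ agents on a line network such that - there is a centralized convergecast strategy with power $P$, and no deterministic distributed algorithm solves convergecast on this configuration with power $(2-\delta)P$; - there is a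 centralized broadcast strategy with power $P$ for the source agent starting at $Pos[1]$, and no deterministic distributed algorithm solves broadcast from the source agent starting at $Pos[1]$ on this configuration with power $(2-\delta)P$. Consequently, for every $\varepsilon>0$ there is no deterministic distributed algorithm for convergecast, and none for broadcast, that is $(2-\varepsilon)$-competitive on lines, that is, for which on every configuration (and, for broadcast, every source agent) on a line network some power of at most $2-\varepsilon$ times the optimal centralized power suffices. -/

import Mathlib

open scoped NNReal

universe u

noncomputable section

/-! ## Line networks and configurations -/

/-- A line network with port numbers: a weighted path with `m + 2` nodes, embedded in the real
line with its left end at `0`, so that the length of an edge is the distance of its end nodes.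
The ports of a node of degree `d` are numbered `1, …, d`: the only port of an end node leads
inwards, and at an inner node `v` port `1` leads to the right if `flipped v`, and otherwise to
the left, port `2` leading the other way. -/
structure LineNetwork where
  m : ℕ
  node : Fin (m + 2) → ℝ
  node_strictMono : StrictMono node
  node_zero : node 0 = 0
  flipped : Fin (m + 2) → Bool

namespace LineNetwork

/-- The length of the line; the line itself is the segment `[0, length]`. -/
def length (N : LineNetwork) : ℝ := N.node (Fin.last _)

/-- The degree of a node. -/
def degree (N : LineNetwork) (v : Fin (N.m + 2)) : ℕ :=
  if v = 0 ∨ v = Fin.last _ then 1 else 2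

/-- The direction (`1` is right, `-1` is left) in which port `p` of the node `v` leads;
it is `0` if `v` has no port `p`. -/
def portDir (N : LineNetwork) (v : Fin (N.m + 2)) (p : ℕ) : SignType :=
  if v = 0 then (if p = 1 then 1 else 0)
  else if v = Fin.last _ then (if p = 1 then -1 else 0)
  else if p = 1 then (if N.flipped v then 1 else -1)
  else if p = 2 then (if N.flipped v then -1 else 1)
  else 0

/-- The port of the node `v` that leads in direction `d`. -/
def portTo (N : LineNetwork) (v : Fin (N.m + 2)) (d : SignType) : ℕ :=
  if N.portDir v 1 = d then 1 else 2

open Classical in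
/-- The node located at the point `x`, if there is one. -/
def nodeAt (N : LineNetwork) (x : ℝ) : Option (Fin (N.m + 2)) :=
  if h : ∃ v, N.node v = x then some h.choose else none

end LineNetwork

/-- A configuration of `n + 1` agents on a line. The agents start at distinct nodes, are listed
from left to right, and both ends of the line are occupied. Agent `0` is the leftmost agent. -/
structure LineConfig (n : ℕ) where
  net : LineNetwork
  start : Fin (n + 1) → Fin (net.m + 2)
  start_strictMono : StrictMono start
  start_zero : start 0 = 0
  start_last : start (Fin.last n) = Fin.last _

/-- The initial position of agent `i`. -/
def LineConfig.pos {n : ℕ} (C : LineConfig n) (i : Fin (n + 1)) : ℝ := C.net.node (C.start i)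

/-! ## Spreading of information -/

/-- `Informed x t₀ j i t`: if agent `a` is at the point `x a s` at the instant `s`, where agents
exchange all their information whenever they are at the same point, then at the instant `t`
agent `i` holds the information that agent `j` had at the initial instant `t₀`. -/
inductive Informed {α ι : Type} [Preorder ι] (x : α → ι → ℝ) (t₀ : ι) (j : α) : α → ι → Prop
  | own : Informed x t₀ j j t₀
  | keep {i : α} {s t : ι} : Informed x t₀ j i s → s ≤ t → Informed x t₀ j i t
  | meet {i i' : α} {t : ι} : Informed x t₀ j i t → x i t = x i' t → Informed x t₀ j i' t

/-! ## The centralized setting -/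

/-- One movement of an agent: walking at unit speed in direction `dir` during the time
`duration`, or waiting if `dir = 0`. -/
structure Leg where
  dir : SignType
  duration : ℝ≥0

/-- The position at time `t` of an agent that starts at `x` at time `0`, performs the given
movements one after the other, and then stays where it is. -/
def walk : ℝ → List Leg → ℝ → ℝ
  | x, [], _ => x
  | x, l :: ls, t =>
      if t ≤ l.duration then x + (l.dir : ℝ) * t
      else walk (x + (l.dir : ℝ) * l.duration) ls (t - l.duration)

/-- The distance travelled in the course of the given movements. -/
def walkCost (ls : List Leg) : ℝ :=
  (ls.map fun l => if l.dir = 0 then (0 : ℝ) else (l.duration : ℝ)).sum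

namespace LineConfig

variable {n : ℕ}

/-- A centralized strategy with power `P`: a finite sequence of movements for every agent, which
keeps the agent on the line and has it travel a distance of at most `P`. -/
def IsStrategy (C : LineConfig n) (P : ℝ) (S : Fin (n + 1) → List Leg) : Prop :=
  (∀ i t, 0 ≤ t → walk (C.pos i) (S i) t ∈ Set.Icc 0 C.net.length) ∧
    ∀ i, walkCost (S i) ≤ P

/-- There is a centralized convergecast strategy with power `P`: at some time, some agent has
the initial information of every agent. -/
def CentralConvergecast (C : LineConfig n) (P : ℝ) : Prop :=
  ∃ S, C.IsStrategy P S ∧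
    ∃ (t : ℝ) (i : Fin (n + 1)), ∀ j, Informed (fun a => walk (C.pos a) (S a)) 0 j i t

/-- There is a centralized broadcast strategy with power `P` for the source agent `src`: at some
time, every agent has the initial information of the source agent. -/
def CentralBroadcast (C : LineConfig n) (src : Fin (n + 1)) (P : ℝ) : Prop :=
  ∃ S, C.IsStrategy P S ∧
    ∃ t : ℝ, ∀ i, Informed (fun a => walk (C.pos a) (S a)) 0 src i t

/-- The optimal power for centralized convergecast. -/
def optConvergecast (C : LineConfig n) : ℝ := sInf {P | C.CentralConvergecast P}

/-- The optimal power for centralized broadcast from `src`. -/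
def optBroadcast (C : LineConfig n) (src : Fin (n + 1)) : ℝ :=
  sInf {P | C.CentralBroadcast src P}

end LineConfig

/-! ## Deterministic distributed algorithms -/

/-- What an agent can decide to do. At a node it can wait or leave through a port. Inside an edge
it can wait, go on in the direction of its last movement, or turn back. -/
inductive Move
  | wait
  | port (p : ℕ)
  | forward
  | backward

/-- A decision of an agent: a move, to be carried out at unit speed until something happens
to the agent (it reaches a node or meets an agent), but at most for the given time. -/
structure Command where
  move : Move
  duration : ℝ
  duration_pos : 0 < duration

/-- The direction from which an agent has come to its present location, as it is perceived there:
at a node, the entry port of the agent (`unmoved` if it has not moved since the start); inside an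
edge, whether its last movement had the same direction as that of the observer. -/
inductive Bearing
  | unmoved
  | port (p : ℕ)
  | same
  | opposite

/-- What an agent perceives at its present location: the time elapsed since the simultaneous
start, the degree of the node (`none` inside an edge), the direction from which it has come, and,
for each other agent present (without its identity), the direction from which that agent has come
and the whole content of its memory. -/
structure Observation (M : Type u) where
  time : ℝ
  degree : Option ℕ
  bearing : Bearing
  others : Multiset (Bearing × M)

/-- A deterministic distributed algorithm, the same for all agents. The initial memory of an
agent depends only on the power it is given, on the degree of its starting node, and on whether
it is the source agent of a broadcast. -/
structure Algorithm where
  Mem : Type u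
  start : (power : ℝ) → (degree : ℕ) → (isSource : Bool) → Mem
  update : Mem → Observation Mem → Mem
  command : Mem → Command

/-- The state of an agent: its position, the direction of its last movement (`0` if it has not
moved yet), its present velocity, the time left until its present command expires, the distance
travelled so far, and its memory. -/
structure Body (M : Type u) where
  pos : ℝ
  last : SignType
  vel : SignType
  timer : ℝ
  used : ℝ
  mem : M

/-- The state of all agents at some time. -/
structure Snapshot (n : ℕ) (M : Type u) where
  time : ℝ
  agent : Fin (n + 1) → Body M

/-- The direction in which an agent at the point `x` moves, when its last movement had
direction `last` and it decides on the given move. A move that is not available there is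
treated as waiting. -/
def LineNetwork.heading (N : LineNetwork) (x : ℝ) (last : SignType) (mv : Move) : SignType :=
  match N.nodeAt x, mv with
  | some v, .port p => N.portDir v p
  | none, .forward => last
  | none, .backward => -last
  | _, _ => 0

/-- The agent `b` begins to carry out the command `c`. -/
def LineNetwork.obey {M : Type u} (N : LineNetwork) (b : Body M) (c : Command) : Body M :=
  let d := N.heading b.pos b.last c.move
  { b with vel := d, last := if d = 0 then b.last else d, timer := c.duration }

/-- The direction from which the agent `b` has come, as perceived by the agent `a` at the same
point. -/
def LineNetwork.bearing {M : Type u} (N : LineNetwork) (a b : Body M) : Bearing :=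
  match N.nodeAt a.pos with
  | some v => if b.last = 0 then .unmoved else .port (N.portTo v (-b.last))
  | none => if b.last = a.last then .same else .opposite

/-- The agent `b` after moving for the time `τ` with its present velocity. -/
def Body.advance {M : Type u} (b : Body M) (τ : ℝ) : Body M :=
  { b with
    pos := b.pos + (b.vel : ℝ) * τ
    timer := b.timer - τ
    used := b.used + (if b.vel = 0 then 0 else τ) }

namespace Snapshot

variable {n : ℕ} {M : Type u}

/-- In the situation `G`, if all agents keep their velocities for the time `τ`, then at the end
something happens to agent `i`: its command expires, or it arrives at a node, or it meets an agent
that it was not together with. -/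
def Alert (N : LineNetwork) (G : Snapshot n M) (τ : ℝ) (i : Fin (n + 1)) : Prop :=
  ((G.agent i).advance τ).timer = 0 ∨
  ((G.agent i).vel ≠ 0 ∧ ∃ v, N.node v = ((G.agent i).advance τ).pos) ∨
  ∃ j, (G.agent i).pos ≠ (G.agent j).pos ∧
    ((G.agent i).advance τ).pos = ((G.agent j).advance τ).pos

/-- The time until the next moment at which something happens to some agent. -/
def delay (N : LineNetwork) (G : Snapshot n M) : ℝ :=
  sInf {τ : ℝ | 0 < τ ∧ ∃ i, G.Alert N τ i}

/-- All agents move with their present velocities until the next event. -/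
def advance (N : LineNetwork) (G : Snapshot n M) : Snapshot n M where
  time := G.time + G.delay N
  agent i := (G.agent i).advance (G.delay N)

/-- Agent `i` notices the next event: it happens to an agent at the location of `i`, possibly
to `i` itself. -/
def Notices (N : LineNetwork) (G : Snapshot n M) (i : Fin (n + 1)) : Prop :=
  ∃ j, ((G.advance N).agent j).pos = ((G.advance N).agent i).pos ∧ G.Alert N (G.delay N) j

open Classical in
/-- What agent `i` perceives in the situation `G`. -/
def observe (N : LineNetwork) (G : Snapshot n M) (i : Fin (n + 1)) : Observation M where
  time := G.time
  degree := (N.nodeAt (G.agent i).pos).map N.degree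
  bearing := N.bearing (G.agent i) (G.agent i)
  others := (Finset.univ.filter fun j => j ≠ i ∧ (G.agent j).pos = (G.agent i).pos).val.map
    fun j => (N.bearing (G.agent i) (G.agent j), (G.agent j).mem)

end Snapshot

namespace Algorithm

variable {n : ℕ}

open Classical in
/-- The situation right after the next event. Exactly those agents that notice the event update
their memory (agents at the same point exchange the contents of their memories) and take a new
decision. -/
def step (A : Algorithm.{u}) (N : LineNetwork) (G : Snapshot n A.Mem) : Snapshot n A.Mem where
  time := (G.advance N).time
  agent i :=
    let b := (G.advance N).agent i
    if G.Notices N i then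
      let mem' := A.update b.mem ((G.advance N).observe N i)
      N.obey { b with mem := mem' } (A.command mem')
    else b

/-- The start of the execution of `A` by agents with power `B`; `isSource` marks the source agent
of a broadcast. -/
def initial (A : Algorithm.{u}) (C : LineConfig n) (B : ℝ) (isSource : Fin (n + 1) → Bool) :
    Snapshot n A.Mem where
  time := 0
  agent i :=
    let mem₀ := A.start B (C.net.degree (C.start i)) (isSource i)
    C.net.obey { pos := C.pos i, last := 0, vel := 0, timer := 0, used := 0, mem := mem₀ }
      (A.command mem₀)

/-- The execution of `A`, as the sequence of the situations right after each event. -/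
def run (A : Algorithm.{u}) (C : LineConfig n) (B : ℝ) (isSource : Fin (n + 1) → Bool) (k : ℕ) :
    Snapshot n A.Mem :=
  (A.step C.net)^[k] (A.initial C B isSource)

/-- `A` solves convergecast with power `B`: at some moment of its execution some agent has the
initial information of every agent, and no agent has travelled more than `B`. -/
def SolvesConvergecast (A : Algorithm.{u}) (C : LineConfig n) (B : ℝ) : Prop :=
  let R := A.run C B fun _ => false
  ∃ k, (∀ i, ((R k).agent i).used ≤ B) ∧
    ∃ i, ∀ j, Informed (fun a s => ((R s).agent a).pos) 0 j i k

/-- `A` solves broadcast from `src` with power `B`: at some moment of its execution every agent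
has the initial information of the source agent, and no agent has travelled more than `B`. -/
def SolvesBroadcast (A : Algorithm.{u}) (C : LineConfig n) (src : Fin (n + 1)) (B : ℝ) : Prop :=
  let R := A.run C B fun i => decide (i = src)
  ∃ k, (∀ i, ((R k).agent i).used ≤ B) ∧
    ∀ i, Informed (fun a s => ((R s).agent a).pos) 0 src i k

/-- `A` is a `c`-competitive convergecast algorithm on lines: on every configuration some power
of at most `c` times the optimal centralized power suffices for it. -/
def ConvergecastCompetitive (A : Algorithm.{u}) (c : ℝ) : Prop :=
  ∀ (n : ℕ) (C : LineConfig n), ∃ B ≤ c * C.optConvergecast, A.SolvesConvergecast C B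

/-- `A` is a `c`-competitive broadcast algorithm on lines. -/
def BroadcastCompetitive (A : Algorithm.{u}) (c : ℝ) : Prop :=
  ∀ (n : ℕ) (C : LineConfig n) (src : Fin (n + 1)),
    ∃ B ≤ c * C.optBroadcast src, A.SolvesBroadcast C src B

end Algorithm

end

/-! Let `q = (1 / 2) ^ m`. The agents sit on a lattice of constant `P * q ^ 2`, in clusters of `m +
1` agents at consecutive nodes (the two end clusters are single agents). Clusters are `(2 - q) * P`
apart, and a cluster is negligibly short.

Centralized upper bound: the agent followed by `s` agents of its cluster goes back by about `(1 - 2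
^ (-s)) * P`, picks up the information and carries it forward by `2 ^ (-s) * P`. A cluster thus
bridges `(1 + 1/2 + ... + 2 ^ (-m)) * P = (2 - q) * P`, just the distance to the next one
(`Clusters.exists_relay`).

Distributed lower bound, with `B = (2 - δ) * P`: inner agents perceive the same surroundings, so as
long as contacts coming from the ends have not reached them, they all move as translates of one
agent `c` in the middle. Call the distance travelled minus the displacement to the right the waste
of an agent; it is monotone in time and at most `2 * B`. Clusters are at least `B + θ` apart for
some `θ > 0`. An agent with waste at least `g * θ` gets no further than `B - g * θ` to the right of
its start, so it meets an untouched agent of the next cluster only if that agent is displaced to the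
left by at least `(g + 1) * θ`. Then so is `c`, and the bound on the waste passes to the next
cluster. Contacts from the left end therefore reach the cluster of `c` only if its waste exceeds `2
* B`, once this cluster is far enough along the line. The mirror image deals with the right end. So
`c` never meets anybody (`informed_run_iff`). -/

/-! ## Motion in an execution -/

/-- The agent `b` translated by `d`. -/
def Body.shift {M : Type u} (b : Body M) (d : ℝ) : Body M := { b with pos := b.pos + d }

theorem Body.shift_advance {M : Type u} (b : Body M) (d τ : ℝ) :
    (b.shift d).advance τ = (b.advance τ).shift d := by
  simp only [Body.shift, Body.advance, add_right_comm]
  rfl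

theorem Body.abs_advance_pos_sub_le {M : Type u} (b : Body M) {τ : ℝ} (hτ : 0 ≤ τ) :
    |(b.advance τ).pos - b.pos| ≤ (b.advance τ).used - b.used := by
  simp only [Body.advance, add_sub_cancel_left]
  cases b.vel <;> simp [abs_of_nonneg hτ]

namespace LineNetwork

theorem nodeAt_node (N : LineNetwork) (v : Fin (N.m + 2)) : N.nodeAt (N.node v) = some v := by
  have h : ∃ w, N.node w = N.node v := ⟨v, rfl⟩
  rw [nodeAt, dif_pos h]
  exact congrArg some (N.node_strictMono.injective h.choose_spec)

theorem nodeAt_eq_none_iff (N : LineNetwork) (x : ℝ) :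
    N.nodeAt x = none ↔ ¬ ∃ v, N.node v = x := by
  unfold nodeAt
  split_ifs with h <;> simp [h]

/-- The points `x` and `y` cannot be told apart by an agent that is located there. -/
def Alike (N : LineNetwork) (x y : ℝ) : Prop :=
  (N.nodeAt x = none ∧ N.nodeAt y = none) ∨
    ∃ v w, N.nodeAt x = some v ∧ N.nodeAt y = some w ∧ N.degree v = N.degree w ∧
      N.portDir v = N.portDir w

variable {N : LineNetwork} {x y : ℝ}

theorem Alike.exists_node_iff (h : N.Alike x y) :
    (∃ v, N.node v = x) ↔ ∃ v, N.node v = y := by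
  rw [← not_iff_not, ← nodeAt_eq_none_iff, ← nodeAt_eq_none_iff]
  rcases h with ⟨h, h'⟩ | ⟨v, w, h, h', -⟩ <;> simp [h, h']

theorem Alike.map_degree (h : N.Alike x y) :
    (N.nodeAt x).map N.degree = (N.nodeAt y).map N.degree := by
  rcases h with ⟨h, h'⟩ | ⟨v, w, h, h', hd, -⟩ <;> simp [*]

theorem Alike.heading (h : N.Alike x y) (l : SignType) (mv : Move) :
    N.heading x l mv = N.heading y l mv := by
  unfold LineNetwork.heading
  rcases h with ⟨h, h'⟩ | ⟨v, w, h, h', -, hp⟩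
  · rw [h, h']
  · rw [h, h']; cases mv <;> simp [hp]

theorem Alike.bearing {M : Type u} {b : Body M} {d : ℝ} (h : N.Alike (b.pos + d) b.pos) :
    N.bearing (b.shift d) (b.shift d) = N.bearing b b := by
  unfold LineNetwork.bearing
  rcases h with ⟨h, h'⟩ | ⟨v, w, h, h', -, hp⟩
  · simp [Body.shift, h, h']
  · simp [Body.shift, h, h', LineNetwork.portTo, hp]

theorem Alike.obey {M : Type u} {b : Body M} {d : ℝ} (h : N.Alike (b.pos + d) b.pos)
    (c : Command) : N.obey (b.shift d) c = (N.obey b c).shift d := by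
  simp [LineNetwork.obey, Body.shift, h.heading]

end LineNetwork

namespace Snapshot

variable {n : ℕ} {M : Type u}

/-- As `sInf ∅ = 0` in the reals, this covers a situation without further events. -/
theorem delay_nonneg (N : LineNetwork) (G : Snapshot n M) : 0 ≤ G.delay N :=
  Real.sInf_nonneg fun _ h => h.1.le

end Snapshot

namespace Algorithm

variable {n : ℕ} (A : Algorithm.{u})

theorem step_pos (N : LineNetwork) (G : Snapshot n A.Mem) (i : Fin (n + 1)) :
    ((A.step N G).agent i).pos = ((G.agent i).advance (G.delay N)).pos := by
  simp only [step, Snapshot.advance]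
  split_ifs <;> rfl

theorem step_used (N : LineNetwork) (G : Snapshot n A.Mem) (i : Fin (n + 1)) :
    ((A.step N G).agent i).used = ((G.agent i).advance (G.delay N)).used := by
  simp only [step, Snapshot.advance]
  split_ifs <;> rfl

theorem run_succ (C : LineConfig n) (B : ℝ) (src : Fin (n + 1) → Bool) (k : ℕ) :
    A.run C B src (k + 1) = A.step C.net (A.run C B src k) :=
  Function.iterate_succ_apply' _ _ _

theorem abs_run_succ_pos_sub_le (C : LineConfig n) (B : ℝ) (src : Fin (n + 1) → Bool) (k : ℕ)
    (i : Fin (n + 1)) :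
    |((A.run C B src (k + 1)).agent i).pos - ((A.run C B src k).agent i).pos| ≤
      ((A.run C B src (k + 1)).agent i).used - ((A.run C B src k).agent i).used := by
  rw [run_succ, step_pos, step_used]
  exact Body.abs_advance_pos_sub_le _ (Snapshot.delay_nonneg _ _)

theorem abs_run_pos_sub_le (C : LineConfig n) (B : ℝ) (src : Fin (n + 1) → Bool)
    (i : Fin (n + 1)) (k : ℕ) :
    |((A.run C B src k).agent i).pos - C.pos i| ≤ ((A.run C B src k).agent i).used := by
  induction k with
  | zero => simp [run, initial, LineNetwork.obey]
  | succ k ih =>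
    have h := A.abs_run_succ_pos_sub_le C B src k i
    rw [abs_le] at *
    constructor <;> linarith [h.1, h.2, ih.1, ih.2]

theorem run_used_mono (C : LineConfig n) (B : ℝ) (src : Fin (n + 1) → Bool) (i : Fin (n + 1)) :
    Monotone fun k => ((A.run C B src k).agent i).used :=
  monotone_nat_of_le_succ fun k => by
    linarith [A.abs_run_succ_pos_sub_le C B src k i,
      abs_nonneg (((A.run C B src (k + 1)).agent i).pos - ((A.run C B src k).agent i).pos)]

/-- Two agents that perceive nothing but the network, and perceive it in the same way, remain
translates of each other. -/
theorem step_agent_eq_shift {N : LineNetwork} {G : Snapshot n A.Mem} {i c : Fin (n + 1)} {d : ℝ}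
    (h : G.agent i = (G.agent c).shift d)
    (hi : ∀ j, ((A.step N G).agent j).pos = ((A.step N G).agent i).pos → j = i)
    (hc : ∀ j, ((A.step N G).agent j).pos = ((A.step N G).agent c).pos → j = c)
    (hN : N.Alike (((A.step N G).agent c).pos + d) ((A.step N G).agent c).pos) :
    (A.step N G).agent i = ((A.step N G).agent c).shift d := by
  simp only [step_pos] at hi hc hN
  have hadv : (G.advance N).agent i = ((G.advance N).agent c).shift d := by
    simp only [Snapshot.advance, h, Body.shift_advance]
  -- An agent that is alone after the step has not just met anybody, so only its own timer or a node
  -- can alert it. Both are the same for translates at points that look alike.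
  have alert : ∀ a, (∀ j, ((G.agent j).advance (G.delay N)).pos =
      ((G.agent a).advance (G.delay N)).pos → j = a) →
      (G.Notices N a ↔ ((G.agent a).advance (G.delay N)).timer = 0 ∨
        ((G.agent a).vel ≠ 0 ∧ ∃ v, N.node v = ((G.agent a).advance (G.delay N)).pos)) := by
    intro a ha
    constructor
    · rintro ⟨j, hj, hal⟩
      obtain rfl := ha j hj
      rcases hal with hal | hal | ⟨j', hne, he⟩
      · exact .inl hal
      · exact .inr hal
      · exact absurd (congrArg (fun a => (G.agent a).pos) (ha j' he.symm)) hne.symm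
    · exact fun hal => ⟨a, rfl, hal.elim .inl fun hal => .inr (.inl hal)⟩
  have alone : ∀ a, (∀ j, ((G.agent j).advance (G.delay N)).pos =
      ((G.agent a).advance (G.delay N)).pos → j = a) →
      ((G.advance N).observe N a).others = 0 := by
    intro a ha
    simp only [Snapshot.observe, Snapshot.advance, Multiset.map_eq_zero, Finset.val_eq_zero]
    exact Finset.filter_eq_empty_iff.2 fun j _ hj => hj.1 (ha j hj.2)
  have hnot : G.Notices N i ↔ G.Notices N c := by
    rw [alert i hi, alert c hc, h, Body.shift_advance]
    exact or_congr Iff.rfl (and_congr Iff.rfl hN.exists_node_iff)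
  have hobs : (G.advance N).observe N i = (G.advance N).observe N c := by
    have h1 := alone i hi
    have h2 := alone c hc
    have h3 : ((G.advance N).observe N i).degree = ((G.advance N).observe N c).degree := by
      simp only [Snapshot.observe, hadv]
      exact hN.map_degree
    have h4 : ((G.advance N).observe N i).bearing = ((G.advance N).observe N c).bearing := by
      simp only [Snapshot.observe, hadv]
      exact LineNetwork.Alike.bearing hN
    have h5 : ((G.advance N).observe N i).time = ((G.advance N).observe N c).time := rfl
    cases hoi : (G.advance N).observe N i
    cases hoc : (G.advance N).observe N c
    simp_all
  by_cases hn : G.Notices N c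
  · simp only [step, hnot, hn, if_true, hobs, hadv]
    exact LineNetwork.Alike.obey (b := { (G.advance N).agent c with
      mem := A.update ((G.advance N).agent c).mem ((G.advance N).observe N c) }) hN _
  · simp only [step, hnot, hn, if_false, hadv]

end Algorithm

/-! ## Agents that are out of reach -/

/-- A labelling of the agents by which one shows that contacts between agents, spreading in the
direction of the sign `σ` from the agents with label at most `0`, do not get as far as the
agent `c`, if agents travel at most `B`. -/
structure IsBarrier {n : ℕ} (C : LineConfig n) (c : Fin (n + 1)) (B σ : ℝ)
    (ρ : Fin (n + 1) → ℝ) : Prop where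
  abs_le_one : |σ| ≤ 1
  gap : ∀ i j, ρ i < ρ j → B + (ρ j - ρ i) ≤ σ * (C.pos j - C.pos i)
  far : 2 * B < ρ c

/-- Agent `i` has travelled so much against the direction `σ`, or stood so little to gain from
travelling, that it stays at a distance of `ρ i` from its furthest possible position. Agent `c`
has travelled accordingly. -/
def Snapshot.Spent {n : ℕ} {M : Type u} (G : Snapshot n M) (C : LineConfig n) (c : Fin (n + 1))
    (σ : ℝ) (ρ : Fin (n + 1) → ℝ) (i : Fin (n + 1)) : Prop :=
  σ * (G.agent i).pos - (G.agent i).used ≤ σ * C.pos i - ρ i ∧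
    ρ i ≤ (G.agent c).used - σ * ((G.agent c).pos - C.pos c)

theorem mul_le_of_abs_le {σ x y : ℝ} (hσ : |σ| ≤ 1) (h : |x| ≤ y) : σ * x ≤ y :=
  calc σ * x ≤ |σ * x| := le_abs_self _
    _ = |σ| * |x| := abs_mul _ _
    _ ≤ 1 * |x| := by gcongr
    _ ≤ y := by simpa using h

namespace IsBarrier

variable {n : ℕ} {C : LineConfig n} {c : Fin (n + 1)} {B σ : ℝ} {ρ : Fin (n + 1) → ℝ}

/-- This is how contact propagates. If `ρ i < ρ j`, the limited reach of `i` and the gap between the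
starting points force `j` to be displaced against `σ` by at least `ρ j`, and `c` with it. Otherwise
the waste of `c` is already at least `ρ i ≥ ρ j`. -/
theorem spent_of_meet (hb : IsBarrier C c B σ ρ) {M : Type u} {G : Snapshot n M}
    {i j : Fin (n + 1)} (hi : G.Spent C c σ ρ i) (hB : (G.agent i).used ≤ B)
    (hj : (G.agent j).pos = (G.agent c).pos + (C.pos j - C.pos c))
    (hju : (G.agent j).used = (G.agent c).used) (hu : 0 ≤ (G.agent c).used)
    (hij : (G.agent i).pos = (G.agent j).pos) : G.Spent C c σ ρ j := by
  obtain ⟨h1, h2⟩ := hi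
  have key : ρ j ≤ (G.agent c).used - σ * ((G.agent c).pos - C.pos c) := by
    rcases lt_or_ge (ρ i) (ρ j) with h | h
    · have := hb.gap i j h
      rw [hij, hj] at h1
      linarith
    · exact h.trans h2
  refine ⟨?_, key⟩
  rw [hj, hju]
  linarith

/-- The waste of `c` is at most twice the distance it has travelled, hence at most `2 * B < ρ c`. -/
theorem not_spent (hb : IsBarrier C c B σ ρ) {M : Type u} {G : Snapshot n M}
    (hB : (G.agent c).used ≤ B) (h : |(G.agent c).pos - C.pos c| ≤ (G.agent c).used) :
    ¬ G.Spent C c σ ρ c := by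
  rintro ⟨-, h2⟩
  rw [abs_sub_comm] at h
  have := mul_le_of_abs_le hb.abs_le_one h
  linarith [hb.far]

/-- The waste never decreases, since a displacement costs at least its length. -/
theorem spent_run_succ (hb : IsBarrier C c B σ ρ) {A : Algorithm.{u}} {B' : ℝ}
    {src : Fin (n + 1) → Bool} {k : ℕ} {i : Fin (n + 1)}
    (h : (A.run C B' src k).Spent C c σ ρ i) : (A.run C B' src (k + 1)).Spent C c σ ρ i := by
  have h1 := mul_le_of_abs_le hb.abs_le_one (A.abs_run_succ_pos_sub_le C B' src k i)
  have h2 := mul_le_of_abs_le hb.abs_le_one (A.abs_run_succ_pos_sub_le C B' src k c)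
  exact ⟨by linarith [h.1], by linarith [h.2]⟩

theorem _root_.Snapshot.spent_run_zero (A : Algorithm.{u}) (B' : ℝ)
    (src : Fin (n + 1) → Bool) {i : Fin (n + 1)} (h : ρ i ≤ 0) :
    (A.run C B' src 0).Spent C c σ ρ i := by
  simp [Snapshot.Spent, Algorithm.run, Algorithm.initial, LineNetwork.obey, h]

end IsBarrier

variable {n : ℕ} {C : LineConfig n}

theorem LineConfig.pos_injective (C : LineConfig n) : Function.Injective C.pos :=
  C.net.node_strictMono.injective.comp C.start_strictMono.injective

/-! ### Isolation of an agent between two barriers -/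

section Barrier

variable {c : Fin (n + 1)} {B σ₁ σ₂ : ℝ} {ρ₁ ρ₂ : Fin (n + 1) → ℝ}
  (hb₁ : IsBarrier C c B σ₁ ρ₁) (hb₂ : IsBarrier C c B σ₂ ρ₂)
  {A : Algorithm.{u}} {B' : ℝ} {src : Fin (n + 1) → Bool}
  (halike : ∀ i, 0 < ρ₁ i → 0 < ρ₂ i → ∀ z, |z| ≤ B →
    C.net.Alike (C.pos i + z) (C.pos c + z))
  (hsrc : ∀ i, 0 < ρ₁ i → 0 < ρ₂ i → src i = src c)

include hb₁ hb₂ in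
/-- Agents that are not spent, and are translates of agent `c`, can only be met by spent agents,
and agent `c` can be met by no agent. -/
theorem eq_of_meet {k : ℕ} {G : Snapshot n A.Mem} (hG : G = A.run C B' src k)
    (hB : ∀ i, (G.agent i).used ≤ B)
    (hc : ∀ i, G.Spent C c σ₁ ρ₁ i ∨ G.Spent C c σ₂ ρ₂ i ∨
      (G.agent i).pos = (G.agent c).pos + (C.pos i - C.pos c) ∧
        (G.agent i).used = (G.agent c).used) {i j : Fin (n + 1)}
    (hi₁ : ¬ G.Spent C c σ₁ ρ₁ i) (hi₂ : ¬ G.Spent C c σ₂ ρ₂ i)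
    (hij : (G.agent j).pos = (G.agent i).pos) : j = i := by
  have hu : 0 ≤ (G.agent c).used := by
    rw [hG]; exact (abs_nonneg _).trans (A.abs_run_pos_sub_le C B' src c k)
  obtain ⟨hp, hus⟩ := ((hc i).resolve_left hi₁).resolve_left hi₂
  rcases hc j with h | h | ⟨hp', -⟩
  · exact absurd (hb₁.spent_of_meet h (hB j) hp hus hu hij) hi₁
  · exact absurd (hb₂.spent_of_meet h (hB j) hp hus hu hij) hi₂
  · exact C.pos_injective (by linarith)

include hb₁ hb₂ halike hsrc in
-- The invariant of the execution: an agent touched by neither barrier is in the same state as `c`,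
-- memory included. Agents that differ from `c` at the outset, such as those at the ends or the
-- source, must have a label at most `0` and count as spent from the start.
theorem run_agent_spent_or_eq_shift (k : ℕ) (hB : ∀ i, ((A.run C B' src k).agent i).used ≤ B)
    (i : Fin (n + 1)) :
    (A.run C B' src k).Spent C c σ₁ ρ₁ i ∨ (A.run C B' src k).Spent C c σ₂ ρ₂ i ∨
      (0 < ρ₁ i ∧ 0 < ρ₂ i ∧ (A.run C B' src k).agent i =
        ((A.run C B' src k).agent c).shift (C.pos i - C.pos c)) := by
  induction k generalizing i with
  | zero =>
    rcases le_or_gt (ρ₁ i) 0 with h₁ | h₁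
    · exact .inl (Snapshot.spent_run_zero A B' src h₁)
    rcases le_or_gt (ρ₂ i) 0 with h₂ | h₂
    · exact .inr (.inl (Snapshot.spent_run_zero A B' src h₂))
    refine .inr (.inr ⟨h₁, h₂, ?_⟩)
    have hB0 : 0 ≤ B := by
      simpa [Algorithm.run, Algorithm.initial, LineNetwork.obey] using hB c
    have ha := halike i h₁ h₂ 0 (by simpa using hB0)
    rw [add_zero, add_zero] at ha
    have hd : C.net.degree (C.start i) = C.net.degree (C.start c) := by
      have := ha.map_degree
      simpa [LineConfig.pos, LineNetwork.nodeAt_node] using this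
    simp only [Algorithm.run, Algorithm.initial, Function.iterate_zero, id, hd, hsrc i h₁ h₂]
    rw [← LineNetwork.Alike.obey]
    · simp [Body.shift]
    · simpa using ha
  | succ k ih =>
    have ih := ih fun i => (A.run_used_mono C B' src i (Nat.le_succ k)).trans (hB i)
    set H := A.run C B' src (k + 1) with hH
    -- Positions and distances travelled are settled before the memories are updated. They suffice
    -- to exclude meetings, and this in turn shows that the updates agree.
    have hweak : ∀ i, H.Spent C c σ₁ ρ₁ i ∨ H.Spent C c σ₂ ρ₂ i ∨
        (H.agent i).pos = (H.agent c).pos + (C.pos i - C.pos c) ∧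
          (H.agent i).used = (H.agent c).used := by
      intro i
      rcases ih i with h | h | ⟨-, -, h⟩
      · exact .inl (hb₁.spent_run_succ h)
      · exact .inr (.inl (hb₂.spent_run_succ h))
      · refine .inr (.inr ?_)
        rw [hH, A.run_succ]
        simp only [A.step_pos, A.step_used, h, Body.shift_advance]
        exact ⟨rfl, rfl⟩
    by_cases hi₁ : H.Spent C c σ₁ ρ₁ i
    · exact .inl hi₁
    by_cases hi₂ : H.Spent C c σ₂ ρ₂ i
    · exact .inr (.inl hi₂)
    have habs := A.abs_run_pos_sub_le C B' src c (k + 1)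
    rcases ih i with h | h | ⟨h₁, h₂, h⟩
    · exact .inl (hb₁.spent_run_succ h)
    · exact .inr (.inl (hb₂.spent_run_succ h))
    refine .inr (.inr ⟨h₁, h₂, ?_⟩)
    have hal := halike i h₁ h₂ ((H.agent c).pos - C.pos c) (habs.trans (hB c))
    have hai : ∀ j, (H.agent j).pos = (H.agent i).pos → j = i := fun j hj =>
      eq_of_meet hb₁ hb₂ hH hB hweak hi₁ hi₂ hj
    have hac : ∀ j, (H.agent j).pos = (H.agent c).pos → j = c := fun j hj =>
      eq_of_meet hb₁ hb₂ hH hB hweak (hb₁.not_spent (hB c) habs) (hb₂.not_spent (hB c) habs) hj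
    rw [hH, A.run_succ] at hai hac hal ⊢
    refine A.step_agent_eq_shift h hai hac ?_
    convert hal using 1 <;> ring

include hb₁ hb₂ halike hsrc in
-- Since `c` meets nobody, no information enters or leaves it.
theorem informed_run_iff {k : ℕ} (hB : ∀ i, ((A.run C B' src k).agent i).used ≤ B)
    {i j : Fin (n + 1)}
    (h : Informed (fun a s => ((A.run C B' src s).agent a).pos) 0 j i k) : j = c ↔ i = c := by
  have hmeet : ∀ s ≤ k, ∀ a, ((A.run C B' src s).agent a).pos =
      ((A.run C B' src s).agent c).pos → a = c := by
    intro s hs a ha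
    have hBs : ∀ i, ((A.run C B' src s).agent i).used ≤ B := fun i =>
      (A.run_used_mono C B' src i hs).trans (hB i)
    have habs := A.abs_run_pos_sub_le C B' src c s
    refine eq_of_meet hb₁ hb₂ rfl hBs (fun i => ?_) (hb₁.not_spent (hBs c) habs)
      (hb₂.not_spent (hBs c) habs) ha
    rcases run_agent_spent_or_eq_shift hb₁ hb₂ halike hsrc s hBs i with h | h | ⟨-, -, h⟩
    · exact .inl h
    · exact .inr (.inl h)
    · exact .inr (.inr ⟨by rw [h]; rfl, by rw [h]; rfl⟩)
  suffices H : ∀ t, Informed (fun a s => ((A.run C B' src s).agent a).pos) 0 j i t → t ≤ k →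
      (j = c ↔ i = c) from H k h le_rfl
  clear h
  intro t h
  induction h with
  | own => exact fun _ => Iff.rfl
  | keep _ hst ih => exact fun ht => ih (hst.trans ht)
  | @meet a a' s _ heq ih =>
    intro hs
    rw [ih hs]
    constructor
    · rintro rfl
      exact hmeet s hs _ heq.symm
    · rintro rfl
      exact hmeet s hs _ heq

end Barrier

/-! ## Relaying information from left to right -/

section Relay

/-- Wait for the time `T`, then go to the left by `a`, then to the right by `b`. -/
def relayLegs (T a b : ℝ) : List Leg :=
  [⟨0, T.toNNReal⟩, ⟨-1, a.toNNReal⟩, ⟨1, b.toNNReal⟩]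

variable {x T a b t : ℝ}

theorem walkCost_relayLegs (ha : 0 ≤ a) (hb : 0 ≤ b) : walkCost (relayLegs T a b) = a + b := by
  simp [walkCost, relayLegs, ha, hb]

theorem walk_relayLegs (hT : 0 ≤ T) (ha : 0 ≤ a) (hb : 0 ≤ b) :
    walk x (relayLegs T a b) t =
      if t ≤ T then x else if t - T ≤ a then x - (t - T)
      else if t - T - a ≤ b then x - a + (t - T - a) else x - a + b := by
  simp only [walk, relayLegs, Real.coe_toNNReal _ hT, Real.coe_toNNReal _ ha,
    Real.coe_toNNReal _ hb]
  split_ifs <;> simp [sub_eq_add_neg]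

theorem walk_relayLegs_mem_Icc {lo hi : ℝ} (hT : 0 ≤ T) (ha : 0 ≤ a) (hb : 0 ≤ b)
    (h1 : lo ≤ x - a) (h2 : x ≤ hi) (h3 : x - a + b ≤ hi) :
    walk x (relayLegs T a b) t ∈ Set.Icc lo hi := by
  rw [walk_relayLegs hT ha hb, Set.mem_Icc]
  split_ifs <;> constructor <;> linarith

theorem walk_relayLegs_turn (hT : 0 ≤ T) (ha : 0 ≤ a) (hb : 0 ≤ b) :
    walk x (relayLegs T a b) (T + a) = x - a := by
  rw [walk_relayLegs hT ha hb]
  split_ifs <;> linarith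

theorem walk_relayLegs_end (hT : 0 ≤ T) (ha : 0 ≤ a) (hb : 0 ≤ b) (ht : T + a + b ≤ t) :
    walk x (relayLegs T a b) t = x - a + b := by
  rw [walk_relayLegs hT ha hb]
  split_ifs <;> linarith

end Relay

namespace LineConfig

variable {n : ℕ} {C : LineConfig n}

/-- If every agent `i`, starting between `E i` and the right end of the line, can go to `E i` and
from there to `E (i + 1)` with power `P`, then the information of all agents can be relayed from
left to right. -/
theorem exists_relay {P : ℝ} (E : ℕ → ℝ) (h0 : 0 ≤ E 0) (hmono : Monotone E)
    (hlast : E (n + 1) ≤ C.net.length) (hpos : ∀ i : Fin (n + 1), E i ≤ C.pos i)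
    (hcost : ∀ i : Fin (n + 1), C.pos i - E i + (E (i + 1) - E i) ≤ P) :
    ∃ S, C.IsStrategy P S ∧ ∃ t : ℝ, ∀ i j, j ≤ i →
      Informed (fun a => walk (C.pos a) (S a)) 0 j i t := by
  have ha : ∀ i : Fin (n + 1), 0 ≤ C.pos i - E i := fun i => sub_nonneg.2 (hpos i)
  have hb : ∀ i : ℕ, 0 ≤ E (i + 1) - E i := fun i => sub_nonneg.2 (hmono (Nat.le_succ i))
  have hP : 0 ≤ P := (add_nonneg (ha 0) (hb _)).trans (hcost 0)
  have hT : ∀ i : ℕ, 0 ≤ i * P := fun i => by positivity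
  have hlen : ∀ i, C.pos i ≤ C.net.length := fun i =>
    C.net.node_strictMono.monotone (Fin.le_last _)
  set S : Fin (n + 1) → List Leg := fun i =>
    relayLegs ((i : ℕ) * P) (C.pos i - E i) (E (i + 1) - E i) with hS
  refine ⟨S, ⟨fun i t _ => ?_, fun i => ?_⟩, (n + 1 : ℝ) * P, ?_⟩
  · refine walk_relayLegs_mem_Icc (hT i) (ha i) (hb i) ?_ (hlen i) ?_
    · linarith [hmono (Nat.zero_le i)]
    · linarith [hmono (show (i : ℕ) + 1 ≤ n + 1 by omega)]
  · rw [hS, walkCost_relayLegs (ha i) (hb i)]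
    exact hcost i
  have key : ∀ (k : ℕ) (hk : k < n + 1), ∀ j : Fin (n + 1), j ≤ (⟨k, hk⟩ : Fin (n + 1)) →
      Informed (fun a => walk (C.pos a) (S a)) 0 j ⟨k, hk⟩ ((k + 1 : ℝ) * P) := by
    intro k
    induction k with
    | zero =>
      intro hk j hj
      obtain rfl : j = ⟨0, hk⟩ := le_antisymm hj (Nat.zero_le _)
      exact .keep .own (by positivity)
    | succ k ih =>
      intro hk j hj
      rcases hj.eq_or_lt with rfl | hj
      · exact .keep .own (by positivity)
      have hj' : j ≤ (⟨k, by omega⟩ : Fin (n + 1)) := Nat.le_of_lt_succ hj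
      have hinf := ih (by omega) j hj'
      have hc := hcost ⟨k + 1, hk⟩
      have hc' := hcost ⟨k, by omega⟩
      have hak := ha ⟨k + 1, hk⟩
      have hbk := hb (k + 1)
      push_cast at hc hc' hak hbk ⊢
      -- Agent `i` is active only between `i * P` and `(i + 1) * P`. At the chosen instant agent `k
      -- + 1` turns at `E (k + 1)`, where agent `k` has been waiting since it finished.
      refine .keep (s := ((k + 1 : ℕ) : ℝ) * P + (C.pos ⟨k + 1, hk⟩ - E (k + 1)))
        (.meet (.keep hinf ?_) ?_) ?_
      · push_cast; linarith
      · simp only [hS]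
        rw [walk_relayLegs_turn (hT (k + 1)) hak hbk,
          walk_relayLegs_end (hT k) (ha ⟨k, by omega⟩) (hb k)]
        · ring
        · push_cast at hak ⊢; linarith
      · push_cast; linarith
  intro i j hij
  refine .keep (key i i.2 j hij) ?_
  have : (i : ℝ) ≤ n := by exact_mod_cast Nat.le_of_lt_succ i.2
  gcongr

/-- Needed to bound the infimum that defines the optimal power. -/
theorem centralConvergecast_nonneg {P : ℝ} (h : C.CentralConvergecast P) : 0 ≤ P := by
  obtain ⟨S, hS, -⟩ := h
  refine le_trans (List.sum_nonneg ?_) (hS.2 0)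
  simp only [List.mem_map]
  rintro _ ⟨l, -, rfl⟩
  split_ifs <;> simp

theorem centralBroadcast_nonneg {src : Fin (n + 1)} {P : ℝ} (h : C.CentralBroadcast src P) :
    0 ≤ P := by
  obtain ⟨S, hS, -⟩ := h
  refine le_trans (List.sum_nonneg ?_) (hS.2 0)
  simp only [List.mem_map]
  rintro _ ⟨l, -, rfl⟩
  split_ifs <;> simp

end LineConfig

/-! ## Lattices -/

/-- The line network with nodes at the points `0, h, 2 * h, …, (m + 1) * h`. At every inner node
port `1` leads to the left. -/
def latticeNetwork (h : ℝ) (hh : 0 < h) (m : ℕ) : LineNetwork where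
  m := m
  node v := v * h
  node_strictMono v w hvw := by
    have : (v : ℝ) < w := by exact_mod_cast hvw
    exact mul_lt_mul_of_pos_right this hh
  node_zero := by simp
  flipped _ := false

/-- Translation by a multiple of `h` preserves the lattice, and all inner nodes have degree `2` and
the same port orientation. -/
theorem latticeNetwork_alike {h : ℝ} {hh : 0 < h} {m : ℕ} {x y : ℝ} {k : ℤ} (hk : x = y + k * h)
    (hx : 0 < x) (hx' : x < (m + 1) * h) (hy : 0 < y) (hy' : y < (m + 1) * h) :
    (latticeNetwork h hh m).Alike x y := by
  have inner : ∀ v : Fin ((latticeNetwork h hh m).m + 2), 0 < (latticeNetwork h hh m).node v →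
      (latticeNetwork h hh m).node v < (m + 1) * h → v ≠ 0 ∧ v ≠ Fin.last _ := by
    rintro v h1 h2
    constructor
    · rintro rfl
      exact h1.ne' (latticeNetwork h hh m).node_zero
    · rintro rfl
      refine h2.ne ?_
      change ((m + 1 : ℕ) : ℝ) * h = _
      push_cast
      rfl
  have trans : ∀ {x y : ℝ} {k : ℤ}, x = y + k * h → 0 < x → x < (m + 1) * h →
      (∃ v, (latticeNetwork h hh m).node v = y) → ∃ v, (latticeNetwork h hh m).node v = x := by
    rintro x _ k rfl hx hx' ⟨v, rfl⟩
    change 0 < (v : ℝ) * h + k * h at hx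
    change (v : ℝ) * h + k * h < _ at hx'
    have h1 : (0 : ℝ) < (v : ℝ) + k := by
      rw [← add_mul] at hx
      exact pos_of_mul_pos_left hx hh.le
    have h2 : (v : ℝ) + k < m + 1 := by
      rw [← add_mul] at hx'
      exact lt_of_mul_lt_mul_right hx' hh.le
    have h1' : 0 < (v : ℤ) + k := by exact_mod_cast h1
    have h2' : (v : ℤ) + k < m + 1 := by exact_mod_cast h2
    refine ⟨⟨((v : ℤ) + k).toNat, show _ < m + 2 by omega⟩, ?_⟩
    change (((((v : ℤ) + k).toNat : ℕ) : ℝ)) * h = (v : ℝ) * h + k * h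
    have : ((((v : ℤ) + k).toNat : ℕ) : ℝ) = (v : ℝ) + k := by
      have := Int.toNat_of_nonneg h1'.le
      exact_mod_cast this
    rw [this, add_mul]
  by_cases hex : ∃ v, (latticeNetwork h hh m).node v = y
  · right
    obtain ⟨v, rfl⟩ := trans hk hx hx' hex
    obtain ⟨w, rfl⟩ := hex
    refine ⟨v, w, LineNetwork.nodeAt_node _ _, LineNetwork.nodeAt_node _ _, ?_, ?_⟩
    · have hv := inner v hx hx'
      have hw := inner w hy hy'
      rw [LineNetwork.degree, LineNetwork.degree, if_neg (not_or.2 hv), if_neg (not_or.2 hw)]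
    · have hv := inner v hx hx'
      have hw := inner w hy hy'
      funext p
      rw [LineNetwork.portDir, LineNetwork.portDir, if_neg hv.1, if_neg hv.2, if_neg hw.1,
        if_neg hw.2]
      rfl
  · left
    rw [LineNetwork.nodeAt_eq_none_iff, LineNetwork.nodeAt_eq_none_iff]
    exact ⟨fun h' => hex (trans (k := -k) (by push_cast; linarith) hy hy' h'), hex⟩

/-! ## The hard configuration -/

namespace Clusters

/-- The cluster of the agent `i`, where the agents `g * (m + 1) - m, …, g * (m + 1)` form the
cluster `g`. -/
def cluster (m i : ℕ) : ℕ := (i + m) / (m + 1)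

/-- The number of agents in the cluster of the agent `i` that come after `i`. -/
def lag (m i : ℕ) : ℕ := m - (i + m) % (m + 1)

theorem lag_le (m i : ℕ) : lag m i ≤ m := Nat.sub_le _ _

theorem add_lag (m i : ℕ) : i + lag m i = cluster m i * (m + 1) := by
  have h1 := Nat.div_add_mod' (i + m) (m + 1)
  have h2 : (i + m) % (m + 1) < m + 1 := Nat.mod_lt _ (Nat.succ_pos m)
  unfold lag cluster
  omega

theorem cluster_lag_eq {m i g s : ℕ} (hs : s ≤ m) (h : i + s = g * (m + 1)) :
    cluster m i = g ∧ lag m i = s := by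
  have h1 : i + m = (m - s) + (m + 1) * g := by rw [mul_comm (m + 1)]; omega
  have h2 : m - s < m + 1 := by omega
  rw [cluster, lag, h1, Nat.add_mul_div_left _ _ (Nat.succ_pos m), Nat.add_mul_mod_self_left,
    Nat.div_eq_of_lt h2, Nat.mod_eq_of_lt h2]
  omega

theorem succ_cases (m i : ℕ) :
    (cluster m (i + 1) = cluster m i ∧ lag m i = lag m (i + 1) + 1) ∨
      (cluster m (i + 1) = cluster m i + 1 ∧ lag m i = 0 ∧ lag m (i + 1) = m) := by
  have h := add_lag m i
  rcases Nat.eq_zero_or_pos (lag m i) with h0 | h0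
  · right
    have := cluster_lag_eq (i := i + 1) (g := cluster m i + 1) (le_refl m) (by
      rw [add_mul]; omega)
    exact ⟨this.1, h0, this.2⟩
  · left
    have := cluster_lag_eq (i := i + 1) (g := cluster m i) (m := m) (s := lag m i - 1)
      (by have := lag_le m i; omega) (by omega)
    exact ⟨this.1, by omega⟩

/-- The distance of consecutive clusters, as a multiple of the lattice constant. -/
def period (m : ℕ) : ℕ := 2 * 4 ^ m - 2 ^ m

/-- The number of the starting node of the agent `i`. -/
def index (m i : ℕ) : ℕ := cluster m i * period m - lag m i

theorem two_pow_le_four_pow (m : ℕ) : 2 ^ m ≤ 4 ^ m := Nat.pow_le_pow_left (by norm_num) m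

theorem lt_period (m : ℕ) : m < period m := by
  have h1 := two_pow_le_four_pow m
  have h2 : m < 2 ^ m := Nat.lt_two_pow_self
  unfold period
  omega

/-- The subtraction in `index` is never truncated: cluster `0` consists of agent `0` alone, whose
lag is `0`, and later clusters start beyond `m`. -/
theorem index_add_lag (m i : ℕ) : index m i + lag m i = cluster m i * period m := by
  refine Nat.sub_add_cancel ?_
  rcases Nat.eq_zero_or_pos (cluster m i) with h | h
  · have := add_lag m i
    rw [h, zero_mul] at this
    omega
  · exact ((lag_le m i).trans (lt_period m).le).trans (Nat.le_mul_of_pos_left _ h)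

theorem index_strictMono (m : ℕ) : StrictMono (index m) := by
  refine strictMono_nat_of_lt_succ fun i => ?_
  have h1 := index_add_lag m i
  have h2 := index_add_lag m (i + 1)
  have h3 := lt_period m
  rcases succ_cases m i with ⟨h, h'⟩ | ⟨h, h', h''⟩
  · rw [h] at h2; omega
  · rw [h, add_mul] at h2; omega

theorem index_zero (m : ℕ) : index m 0 = 0 := by
  have := cluster_lag_eq (i := 0) (g := 0) (Nat.zero_le m) (by simp)
  simp [index, this.1, this.2]

theorem cast_index (m i : ℕ) :
    (index m i : ℝ) = cluster m i * (2 * 4 ^ m - 2 ^ m) - lag m i := by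
  have h : ((index m i + lag m i : ℕ) : ℝ) = (cluster m i * period m : ℕ) := by
    rw [index_add_lag]
  have hp : (period m : ℝ) = 2 * 4 ^ m - 2 ^ m := by
    have := two_pow_le_four_pow m
    rw [period, Nat.cast_sub (by omega)]
    push_cast
    rfl
  push_cast [hp] at h
  linarith

/-- The configuration of the agents `0, …, n + 1` of the clusters on a lattice. -/
def config (h : ℝ) (hh : 0 < h) (m n : ℕ) : LineConfig (n + 1) where
  net := latticeNetwork h hh (index m (n + 1) - 1)
  start i := ⟨index m i, by
    change index m i < index m (n + 1) - 1 + 2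
    have := (index_strictMono m).monotone (Nat.le_of_lt_succ i.2)
    omega⟩
  start_strictMono i j hij := index_strictMono m hij
  start_zero := Fin.ext (index_zero m)
  start_last := by
    refine Fin.ext ?_
    have : index m 0 < index m (n + 1) := index_strictMono m (Nat.succ_pos n)
    change index m (n + 1) = index m (n + 1) - 1 + 1
    omega

theorem config_length (h : ℝ) (hh : 0 < h) (m n : ℕ) :
    (config h hh m n).net.length = index m (n + 1) * h := by
  have := congrArg (config h hh m n).net.node (config h hh m n).start_last
  rw [LineNetwork.length, ← this]
  rfl

theorem config_alike {h : ℝ} {hh : 0 < h} {m n : ℕ} (i j : Fin (n + 2)) {z : ℝ}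
    (hi : 0 < (config h hh m n).pos i + z)
    (hi' : (config h hh m n).pos i + z < index m (n + 1) * h)
    (hj : 0 < (config h hh m n).pos j + z)
    (hj' : (config h hh m n).pos j + z < index m (n + 1) * h) :
    (config h hh m n).net.Alike ((config h hh m n).pos i + z) ((config h hh m n).pos j + z) := by
  have hn : ((index m (n + 1) - 1 : ℕ) : ℝ) + 1 = index m (n + 1) := by
    have : index m 0 < index m (n + 1) := index_strictMono m (Nat.succ_pos n)
    exact_mod_cast Nat.sub_add_cancel (Nat.one_le_of_lt this)
  rw [← hn] at hi' hj'
  refine latticeNetwork_alike (hh := hh) (k := (index m i : ℤ) - index m j) ?_ hi hi' hj hj'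
  change (index m i : ℝ) * h + z = (index m j : ℝ) * h + z + _
  push_cast
  ring

/-! ### Estimates for the starting positions -/

section Positions

variable {P q : ℝ} {m : ℕ}

/-- The period is `(2 - q) / q ^ 2`, an integer. -/
theorem index_mul (hq : q = (1 / 2) ^ m) (i : ℕ) : (index m i : ℝ) * (P * q ^ 2) =
    P * (cluster m i * (2 - q) - lag m i * q ^ 2) := by
  have h1 : (2 : ℝ) ^ m * q = 1 := by rw [hq, ← mul_pow]; norm_num
  have h2 : (4 : ℝ) ^ m = 2 ^ m * 2 ^ m := by rw [← mul_pow]; norm_num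
  rw [cast_index, h2]
  linear_combination (P * cluster m i * (2 * 2 ^ m * q + 2 - q)) * h1

theorem natCast_mul_pow_le (s : ℕ) : (s : ℝ) * (1 / 2) ^ s ≤ 1 - (1 / 2) ^ s := by
  have h1 : ((s + 1 : ℕ) : ℝ) ≤ 2 ^ s := by exact_mod_cast (Nat.lt_two_pow_self (n := s))
  have h2 : (2 : ℝ) ^ s * (1 / 2) ^ s = 1 := by rw [← mul_pow]; norm_num
  have h3 : (0 : ℝ) ≤ (1 / 2) ^ s := by positivity
  have := mul_le_mul_of_nonneg_right h1 h3
  push_cast at this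
  linarith

theorem lag_mul_le (hq : q = (1 / 2) ^ m) (i : ℕ) :
    (lag m i : ℝ) * q ≤ 1 - (1 / 2) ^ lag m i := by
  refine le_trans ?_ (natCast_mul_pow_le (lag m i))
  rw [hq]
  exact mul_le_mul_of_nonneg_left
    (pow_le_pow_of_le_one (by norm_num) (by norm_num) (lag_le m i)) (Nat.cast_nonneg _)

/-- The gap between the agents of different clusters. -/
theorem sub_ge {δ : ℝ} (hP : 0 < P) (hq : q = (1 / 2) ^ m) (hδ : δ ≤ 1) {i j : ℕ}
    (hij : cluster m i < cluster m j) :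
    (2 - δ) * P + ((cluster m j : ℝ) - cluster m i) * ((δ - 2 * q) * P) ≤
      index m j * (P * q ^ 2) - index m i * (P * q ^ 2) := by
  have hq0 : 0 < q := by rw [hq]; positivity
  have h1 : (1 : ℝ) ≤ (cluster m j : ℝ) - cluster m i := by
    have : ((cluster m i + 1 : ℕ) : ℝ) ≤ cluster m j := by exact_mod_cast hij
    push_cast at this
    linarith
  have h2 : (lag m j : ℝ) * q ≤ 1 := by
    have := lag_mul_le hq j
    have : (0 : ℝ) ≤ (1 / 2) ^ lag m j := by positivity
    linarith
  have h3 : (lag m j : ℝ) * q ^ 2 ≤ q := by nlinarith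
  have h4 : (0 : ℝ) ≤ (lag m i : ℝ) * q ^ 2 := by positivity
  -- This is the slack that remains when the length of a cluster is bounded by `q * P`.
  have h5 : 0 ≤ ((cluster m j : ℝ) - cluster m i - 1) * (2 - δ + q) :=
    mul_nonneg (by linarith) (by linarith)
  rw [index_mul hq, index_mul hq, ← sub_nonneg]
  have : 0 ≤ P * (((cluster m j : ℝ) - cluster m i - 1) * (2 - δ + q) +
    (q - lag m j * q ^ 2) + lag m i * q ^ 2) := mul_nonneg hP.le (by linarith)
  linarith

end Positions

/-! ### The relay through the clusters -/

/-- The point to which information is carried before the agent `i` picks it up. -/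
noncomputable def relayPoint (P : ℝ) (m i : ℕ) : ℝ :=
  P * (cluster m i * (2 - (1 / 2) ^ m) - 1 + (1 / 2) ^ lag m i)

/-- Inside a cluster the lag drops by one and the power of `1 / 2` doubles. At the end of a cluster
the step `P` leads to the first pick-up point of the next cluster. -/
theorem relayPoint_succ (P : ℝ) (m i : ℕ) :
    relayPoint P m (i + 1) = relayPoint P m i + P * (1 / 2) ^ lag m i := by
  rcases succ_cases m i with ⟨h, h'⟩ | ⟨h, h', h''⟩
  · rw [relayPoint, relayPoint, h, h', pow_succ]; ring
  · rw [relayPoint, relayPoint, h, h', h'']; push_cast; ring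

theorem relayPoint_zero (P : ℝ) (m : ℕ) : relayPoint P m 0 = 0 := by
  have := cluster_lag_eq (i := 0) (g := 0) (Nat.zero_le m) (by simp)
  simp [relayPoint, this.1, this.2]

theorem exists_relay {P : ℝ} (hP : 0 < P) {m n : ℕ} (hm : 2 ≤ m) (hn : lag m (n + 1) = m)
    (hh : 0 < P * ((1 / 2) ^ m) ^ 2) :
    ∃ S, (config _ hh m n).IsStrategy P S ∧ ∃ t : ℝ, ∀ i j, j ≤ i →
      Informed (fun a => walk ((config _ hh m n).pos a) (S a)) 0 j i t := by
  set q : ℝ := (1 / 2) ^ m with hq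
  have hq0 : 0 < q := by rw [hq]; positivity
  have hq1 : q ≤ 1 / 4 := by
    rw [hq]
    calc (1 / 2 : ℝ) ^ m ≤ (1 / 2) ^ 2 := pow_le_pow_of_le_one (by norm_num) (by norm_num) hm
      _ = 1 / 4 := by norm_num
  have hpos : ∀ i : Fin (n + 2), (config _ hh m n).pos i =
      P * (cluster m i * (2 - q) - lag m i * q ^ 2) := fun i => index_mul hq i
  refine LineConfig.exists_relay (relayPoint P m) (relayPoint_zero P m).ge
    (monotone_nat_of_le_succ fun i => ?_) ?_ (fun i => ?_) fun i => ?_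
  · rw [relayPoint_succ]
    have : 0 ≤ P * (1 / 2) ^ lag m i := by positivity
    linarith
  -- The last agent is the first of its cluster, so its final relay point lies `(1 - 2 * q) * P`
  -- before the nominal position of the cluster. This exceeds the offset `m * q ^ 2 * P` of the end
  -- of the line because `q ≤ 1 / 4`.
  · rw [config_length, index_mul hq, relayPoint_succ, relayPoint, hn, ← hq, ← mul_add]
    have h1 := lag_mul_le hq (n + 1)
    rw [hn, ← hq] at h1
    have h2 : (m : ℝ) * q ^ 2 ≤ q := by nlinarith
    exact mul_le_mul_of_nonneg_left (by linarith) hP.le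
  · rw [hpos, relayPoint, ← hq]
    have h1 := lag_mul_le hq i
    have h2 : (lag m i : ℝ) * q ^ 2 ≤ lag m i * q :=
      mul_le_mul_of_nonneg_left (by nlinarith) (Nat.cast_nonneg _)
    exact mul_le_mul_of_nonneg_left (by linarith) hP.le
  -- The power of `1 / 2` cancels: the agent travels exactly `P * (1 - lag m i * q ^ 2)`.
  · rw [hpos, relayPoint_succ, relayPoint, ← hq]
    have : 0 ≤ P * (lag m i * q ^ 2) := by positivity
    linarith

end Clusters

/-! ### The lower bound -/

open Clusters in
/-- Clusters of agents along a line, for which centralized algorithms need power `P` only, and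
distributed algorithms more than `(2 - δ) * P`. -/
theorem exists_hard_config {δ P : ℝ} (hδ : 0 < δ) (hδ1 : δ ≤ 1) (hP : 0 < P) :
    ∃ (n : ℕ) (C : LineConfig n), C.CentralConvergecast P ∧ C.CentralBroadcast 0 P ∧
      ∀ (A : Algorithm.{u}), ∀ B ≤ (2 - δ) * P,
        ¬ A.SolvesConvergecast C B ∧ ¬ A.SolvesBroadcast C 0 B := by
  obtain ⟨m₀, hm₀⟩ := exists_pow_lt_of_lt_one (half_pos hδ) (by norm_num : (1 / 2 : ℝ) < 1)
  -- The choice of `m₀` gives `2 * q < δ`, so that `θ` is positive; the summand `2` gives `q ≤ 1 /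
  -- 4` for the relay.
  set m := m₀ + 2 with hm
  set q : ℝ := (1 / 2) ^ m with hq
  have hq0 : 0 < q := by rw [hq]; positivity
  have hqδ : 0 < (δ - 2 * q) * P := by
    have : q ≤ (1 / 2) ^ m₀ := pow_le_pow_of_le_one (by norm_num) (by norm_num) (by omega)
    exact mul_pos (by linarith) hP
  set θ := (δ - 2 * q) * P with hθ
  -- The middle cluster is so far from either end that its labels `c * θ` exceed twice the power.
  obtain ⟨c, hc⟩ := exists_nat_gt (2 * ((2 - δ) * P) / θ)
  rw [div_lt_iff₀ hqδ] at hc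
  have hB0 : 0 < (2 - δ) * P := mul_pos (by linarith) hP
  have hc0 : 0 < c := by
    rcases Nat.eq_zero_or_pos c with rfl | h
    · simp at hc; linarith
    · exact h
  -- The line ends at the first agent of cluster `2 * c`, the mirror image of cluster `0`.
  obtain ⟨n, hn⟩ : ∃ n, n + 1 + m = (2 * c) * (m + 1) :=
    ⟨2 * c * (m + 1) - (m + 1), by
      have : m + 1 ≤ 2 * c * (m + 1) := Nat.le_mul_of_pos_left _ (by omega)
      omega⟩
  obtain ⟨hcn, hln⟩ := cluster_lag_eq le_rfl hn
  obtain ⟨hcc, -⟩ := cluster_lag_eq (m := m) (i := c * (m + 1)) (g := c) (Nat.zero_le m) rfl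
  have hcl0 : cluster m 0 = 0 := (cluster_lag_eq (Nat.zero_le m) (by simp)).1
  have hclt : c * (m + 1) < n + 2 := by
    have : m + 1 ≤ c * (m + 1) := Nat.le_mul_of_pos_left _ hc0
    rw [mul_assoc] at hn
    omega
  have hh : 0 < P * q ^ 2 := by positivity
  set C := config _ hh m n with hC
  set d : Fin (n + 2) := ⟨c * (m + 1), hclt⟩ with hd
  have hd0 : (0 : Fin (n + 2)) ≠ d := by
    intro h
    have := congrArg Fin.val h
    simp [hd] at this
    omega
  have hpos : ∀ i, C.pos i = index m i * (P * q ^ 2) := fun _ => rfl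
  have hb₁ : IsBarrier C d ((2 - δ) * P) 1 fun i => cluster m i * θ := by
    refine ⟨by simp, fun i j hij => ?_, by simpa [hd, hcc] using hc⟩
    have hij : cluster m i < cluster m j := by exact_mod_cast lt_of_mul_lt_mul_right hij hqδ.le
    have := sub_ge hP hq hδ1 hij
    rw [hpos, hpos]
    linarith
  have hb₂ : IsBarrier C d ((2 - δ) * P) (-1) fun i => (2 * c - cluster m i) * θ := by
    refine ⟨by simp, fun i j hij => ?_, ?_⟩
    · have hij := lt_of_mul_lt_mul_right hij hqδ.le
      have hij : cluster m j < cluster m i := by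
        have : (cluster m j : ℝ) < cluster m i := by linarith
        exact_mod_cast this
      have := sub_ge hP hq hδ1 hij
      rw [hpos, hpos]
      linarith
    · simp only [hd, hcc]
      linarith
  -- Agents strictly between the end clusters cannot reach the ends of the line with this power, so
  -- they see inner points only.
  have hinner : ∀ i : Fin (n + 2), 0 < cluster m i * θ → 0 < (2 * c - cluster m i) * θ →
      (2 - δ) * P < C.pos i ∧ C.pos i + (2 - δ) * P < index m (n + 1) * (P * q ^ 2) := by
    intro i h1 h2
    have h1' := pos_of_mul_pos_left h1 hqδ.le
    have h2' := pos_of_mul_pos_left h2 hqδ.le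
    have h3 : cluster m 0 < cluster m i := by rw [hcl0]; exact_mod_cast h1'
    have h4 : cluster m i < cluster m (n + 1) := by
      rw [hcn]
      have : (cluster m i : ℝ) < 2 * c := by linarith
      exact_mod_cast this
    have h5 := sub_ge hP hq hδ1 h3
    have h6 := sub_ge hP hq hδ1 h4
    rw [hcl0, index_zero] at h5
    rw [hcn] at h6
    push_cast at h5 h6
    rw [hpos]
    constructor <;> linarith
  have halike : ∀ i : Fin (n + 2), 0 < cluster m i * θ → 0 < (2 * c - cluster m i) * θ → ∀ z,
      |z| ≤ (2 - δ) * P → C.net.Alike (C.pos i + z) (C.pos d + z) := by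
    intro i h1 h2 z hz
    have hi := hinner i h1 h2
    have hj := hinner d (by linarith [hb₁.far]) (by linarith [hb₂.far])
    rw [abs_le] at hz
    exact config_alike i d (by linarith) (by linarith) (by linarith) (by linarith)
  obtain ⟨S, hS, t, hinf⟩ := Clusters.exists_relay hP (n := n) (by omega : 2 ≤ m) hln hh
  refine ⟨n + 1, C, ⟨S, hS, t, Fin.last _, fun j => hinf _ j (Fin.le_last j)⟩,
    ⟨S, hS, t, fun i => hinf i 0 (Fin.zero_le i)⟩, fun A B hB => ⟨?_, ?_⟩⟩
  · rintro ⟨k, hk, i, hi⟩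
    have hk := fun i => (hk i).trans hB
    have key := fun j => informed_run_iff hb₁ hb₂ halike (fun _ _ _ => rfl) hk (hi j)
    exact hd0 ((key 0).2 ((key d).1 rfl))
  · rintro ⟨k, hk, hi⟩
    have hk := fun i => (hk i).trans hB
    refine hd0 ((informed_run_iff hb₁ hb₂ halike (fun i h1 _ => ?_) hk (hi d)).2 rfl)
    -- The source lies in cluster `0`, hence is spent from the start and never compared with `d`.
    have : i ≠ 0 := by rintro rfl; simp [hcl0] at h1
    simp [this, hd0.symm]

theorem theorem6 :
    (∀ δ P : ℝ, 0 < δ → 0 < P → ∃ (n : ℕ) (C : LineConfig n),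
      (C.CentralConvergecast P ∧
        ¬ ∃ A : Algorithm.{u}, A.SolvesConvergecast C ((2 - δ) * P)) ∧
      (C.CentralBroadcast 0 P ∧
        ¬ ∃ A : Algorithm.{u}, A.SolvesBroadcast C 0 ((2 - δ) * P))) ∧
    (∀ ε : ℝ, 0 < ε →
      (¬ ∃ A : Algorithm.{u}, A.ConvergecastCompetitive (2 - ε)) ∧
      (¬ ∃ A : Algorithm.{u}, A.BroadcastCompetitive (2 - ε))) := by
  constructor
  · intro δ P hδ hP
    obtain ⟨n, C, h1, h2, h3⟩ :=
      exists_hard_config.{u} (lt_min hδ one_pos) (min_le_right δ 1) hP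
    have hB : (2 - δ) * P ≤ (2 - min δ 1) * P :=
      mul_le_mul_of_nonneg_right (by linarith [min_le_left δ 1]) hP.le
    exact ⟨n, C, ⟨h1, fun ⟨A, hA⟩ => (h3 A _ hB).1 hA⟩, h2, fun ⟨A, hA⟩ => (h3 A _ hB).2 hA⟩
  · intro ε hε
    obtain ⟨n, C, h1, h2, h3⟩ :=
      exists_hard_config.{u} (lt_min hε one_pos) (min_le_right ε 1) one_pos
    -- Here `x` is the optimal power, which lies between `0` and `1`. Replacing `ε` by `min ε 1`
    -- first makes the factor positive.
    have hle : ∀ x : ℝ, 0 ≤ x → x ≤ 1 → (2 - ε) * x ≤ (2 - min ε 1) * 1 := fun x hx hx1 =>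
      (mul_le_mul_of_nonneg_right (by linarith [min_le_left ε 1]) hx).trans
        (mul_le_mul_of_nonneg_left hx1 (by linarith [min_le_right ε 1]))
    refine ⟨fun ⟨A, hA⟩ => ?_, fun ⟨A, hA⟩ => ?_⟩
    · obtain ⟨B, hB, hs⟩ := hA n C
      have h0 : ∀ P, C.CentralConvergecast P → 0 ≤ P :=
        fun _ => LineConfig.centralConvergecast_nonneg
      exact (h3 A B (hB.trans (hle _ (Real.sInf_nonneg h0) (csInf_le ⟨0, h0⟩ h1)))).1 hs
    · obtain ⟨B, hB, hs⟩ := hA n C 0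
      have h0 : ∀ P, C.CentralBroadcast 0 P → 0 ≤ P :=
        fun _ => LineConfig.centralBroadcast_nonneg
      exact (h3 A B (hB.trans (hle _ (Real.sInf_nonneg h0) (csInf_le ⟨0, h0⟩ h2)))).2 hs
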